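/- \textbf{Conventions.} A separation of a finite graph $G$ on $V$ is a pair $(A,B)$ with $A\cup B=V$ and no edge of $G$ between $A\setminus B$ and $B\setminus A$; its order is $|A\cap B|$, it is proper if $A\ne V\ne B$, its inverse is $(B,A)$, and $(A,B)\le(C,D)$ means $A\subseteq C$ and $D\subseteq B$. Two separations cross if neither is comparable with the other or with its inverse. $S_k$ is the set of separations of order less than $k$, and $S_k^-=\{(A,V): |A|<k\}$. An orientation of $S_k$ is a subset containing exactly one element of each pair $\{(A,B),(B,A)\}\subseteq S_k$; it is consistent if it contains no $(A,B),(C,D)$ (possibly equal) with $(D,C)\le(A,B)$. A $k$-block is a maximal set $X$ of at least $k$ vertices such that no two vertices of $X$ can be separated in $G$ by fewer than $k$ other vertices. A $k$-profile is a consistent orientation $P$ of $S_k$ such that $(A,B),(C,D)\in P$ implies $(B\cap D,A\cup C)\notin P$. Let $$\mathcal B_k=\Big\{\{(A_i,B_i): i=1,\dots,n\}\subseteq S_k : \big|\textstyle\bigcap_i B_i\big|<k\Big\},\qquad \mathcal P_k=\big\{\{(A,B),(C,D),(B\cap D,A\cup C)\}\subseteq S_k\big\}.$$ Let $\mathcal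 F$ be a collection of subsets of $S_k$. An $S_k$-graph over $\mathcal F$ rooted in $S_k^-$ is a pair $(H,\alpha)$, where $H$ is a finite connected bipartite graph with at least one edge, with bipartition $N\cup M$ such that all leaves (vertices of degree 1) lie in $N$, and with a partition of the set of edges at each $m\in M$ into two non-empty classes $E'(m),E''(m)$; and $\alpha$ maps the oriented edges of $H$ to $S_k$ so that (i) $\alpha(v,u)$ is the inverse of $\alpha(u,v)$; (ii) $\alpha(n,m)\in S_k^-$ for every edge $nm$ at a leaf $n$; (iii) $\{\alpha(m,n): m\text{ adjacent to }n\}\in\mathcal F$ for every $n\in N$ that is not a leaf; (iv) $\alpha(n',m)\ge\alpha(m,n'')$ whenever $n'm\in E'(m)$ and $mn''\in E''(m)$. An $S_k$-tree over $\mathcal F$ rooted in $S_k^-$ is a pair $(T,\alpha)$ of a finite tree $T$ with at least one edge and a map $\alpha$ from its oriented edges to $S_k$ satisfying (i), (ii) at all leaves, and (iii) at all nodes that are not leaves. \textbf{Statement.} Let $G$ be the graph on $V=\{0,1,\dots,11\}$ that is the union of the four complete graphs on $$K_0=\{10,11,0,1,2\},\quad K_1=\{1,2,3,4,5\},\quad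 K_2=\{4,5,6,7,8\},\quad K_3=\{7,8,9,10,11\}.$$ Let $(A,B)=(K_0\cup K_1,\,K_2\cup K_3)$ and $(C,D)=(K_1\cup K_2,\,K_3\cup K_0)$. Then: \begin{enumerate} \item The vertex sets of the $K_5$s in $G$ are exactly $K_0,K_1,K_2,K_3$. The pairs $(A,B)$ and $(C,D)$ are crossing separations of $G$ of order 4, with $B\cap C=K_2$, $B\cap D=K_3$, $A\cap C=K_1$ and $A\cap D=K_0$. The proper separations in $S_5$ are exactly $(A,B)$, $(C,D)$, the four separations $(K_i,V\setminus\{v_i\})$, where $v_i=3i$ is the vertex of $K_i$ lying in no other $K_j$, and the inverses of these. Any two distinct non-adjacent vertices are separated by $(A,B)$ or by $(C,D)$ (one of them lies in $A\setminus B$ and the other in $B\setminus A$, or likewise for $C,D$). \item $G$ has exactly four 5-blocks, the sets $K_0,K_1,K_2,K_3$, but no 6-block and no 6-profile. \item There is no $S_6$-graph $(H,\alpha)$ of $G$ over $\mathcal B_6$ or over $\mathcal P_6$, rooted in $S_6^-$, for which $H$ is a tree. Nor is there an $S_6$-tree over $\mathcal B_6$ or over $\mathcal P_6$ rooted in $S_6^-$.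 \item Consequently, it is not true for all finite graphs $G$ and all $k>0$ that $G$ has a $k$-block if and only if it has no $S_k$-graph $(H,\alpha)$ over $\mathcal B_k$ rooted in $S_k^-$ with $H$ a tree; nor that $G$ has a $k$-profile if and only if it has no such $S_k$-graph over $\mathcal P_k$. The same holds with $S_k$-trees instead of $S_k$-graphs $(H,\alpha)$ with $H$ a tree. \end{enumerate} -/

import Mathlib

/-- A separation of the vertex set `V`: a pair `(left, right)` with `left ∪ right = V`. -/
@[ext]
structure Separation (V : Type*) [Fintype V] [DecidableEq V] where
  left : Finset V
  right : Finset V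
  cover : left ∪ right = Finset.univ

namespace Separation

variable {V : Type*} [Fintype V] [DecidableEq V]

/-- The inverse `(B, A)` of `(A, B)`. -/
def inv (s : Separation V) : Separation V :=
  ⟨s.right, s.left, by rw [Finset.union_comm]; exact s.cover⟩

/-- `(A, B) ≤ (C, D)` iff `A ⊆ C` and `D ⊆ B`. -/
instance : LE (Separation V) :=
  ⟨fun s t => s.left ⊆ t.left ∧ t.right ⊆ s.right⟩

/-- The order `|A ∩ B|`. -/
def order (s : Separation V) : ℕ := (s.left ∩ s.right).card

/-- `(A, B)` is a separation of the graph `G`: no edge joins `A \ B` to `B \ A`. -/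
def IsSeparationOf (s : Separation V) (G : SimpleGraph V) : Prop :=
  ∀ a ∈ s.left \ s.right, ∀ b ∈ s.right \ s.left, ¬ G.Adj a b

/-- Neither side is all of `V`. -/
def IsProper (s : Separation V) : Prop :=
  s.left ≠ Finset.univ ∧ s.right ≠ Finset.univ

/-- Two separations are nested if one is comparable with the other or with its inverse. -/
def IsNested (s t : Separation V) : Prop :=
  s ≤ t ∨ t ≤ s ∨ s ≤ t.inv ∨ t.inv ≤ s

/-- For `(A, B)` and `(C, D)`, the separation `(B ∩ D, A ∪ C)`. -/
def corner (s t : Separation V) : Separation V :=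
  ⟨s.right ∩ t.right, s.left ∪ t.left, by
    ext v
    have hs : v ∈ s.left ∪ s.right := by rw [s.cover]; exact Finset.mem_univ v
    have ht : v ∈ t.left ∪ t.right := by rw [t.cover]; exact Finset.mem_univ v
    simp only [Finset.mem_union, Finset.mem_inter, Finset.mem_univ, iff_true] at hs ht ⊢
    tauto⟩

/-- `(A, B)` separates `x` from `y`: one lies in `A \ B` and the other in `B \ A`. -/
def Splits (s : Separation V) (x y : V) : Prop :=
  (x ∈ s.left \ s.right ∧ y ∈ s.right \ s.left) ∨
    (y ∈ s.left \ s.right ∧ x ∈ s.right \ s.left)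

end Separation

section Systems

variable {V : Type*} [Fintype V] [DecidableEq V]

/-- `S_k`: the separations of `G` of order less than `k`. -/
def sepSystem (G : SimpleGraph V) (k : ℕ) : Set (Separation V) :=
  {s | s.IsSeparationOf G ∧ s.order < k}

/-- `S_k⁻`: the separations `(A, V)` with `|A| < k`. -/
def smallSeps (V : Type*) [Fintype V] [DecidableEq V] (k : ℕ) : Set (Separation V) :=
  {s | s.right = Finset.univ ∧ s.left.card < k}

/-- `O` is an orientation of `S`: a subset of `S` containing exactly one element of each
pair `{s, s.inv}` with `s ∈ S`. -/
def IsOrientation (S O : Set (Separation V)) : Prop :=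
  O ⊆ S ∧ (∀ s ∈ S, s ∈ O ∨ s.inv ∈ O) ∧ ∀ s ∈ O, s.inv ∈ O → s.inv = s

/-- No two elements `s`, `t` of `O` point away from each other, that is, `t.inv ≤ s`.
(`s = t` is allowed, so that no `(V, A)` lies in a consistent set.) -/
def IsConsistent (O : Set (Separation V)) : Prop :=
  ∀ s ∈ O, ∀ t ∈ O, ¬ t.inv ≤ s

/-- A `k`-profile of `G`: a consistent orientation of `S_k` such that whenever it contains
`(A, B)` and `(C, D)` it does not contain `(B ∩ D, A ∪ C)`. -/
def IsProfile (G : SimpleGraph V) (k : ℕ) (P : Set (Separation V)) : Prop :=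
  IsOrientation (sepSystem G k) P ∧ IsConsistent P ∧
    ∀ s ∈ P, ∀ t ∈ P, s.corner t ∉ P

/-- `Z` separates `x` from `y` in `G`: every walk from `x` to `y` meets `Z`. -/
def VertexSeparates (G : SimpleGraph V) (Z : Finset V) (x y : V) : Prop :=
  ∀ p : G.Walk x y, ∃ z ∈ Z, z ∈ p.support

/-- No two vertices of `X` can be separated in `G` by fewer than `k` other vertices. -/
def IsInseparable (G : SimpleGraph V) (k : ℕ) (X : Finset V) : Prop :=
  ∀ x ∈ X, ∀ y ∈ X, x ≠ y →
    ∀ Z : Finset V, Z.card < k → x ∉ Z → y ∉ Z → ¬ VertexSeparates G Z x y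

/-- A `k`-block of `G`: an inclusion-maximal inseparable set of at least `k` vertices. -/
def IsBlock (G : SimpleGraph V) (k : ℕ) (X : Finset V) : Prop :=
  Maximal (fun Y : Finset V => k ≤ Y.card ∧ IsInseparable G k Y) X

/-- `𝓑_k`: the sets `{(A_i, B_i)} ⊆ S_k` with `|⋂ B_i| < k`. -/
def blockSets (G : SimpleGraph V) (k : ℕ) : Set (Set (Separation V)) :=
  {F | F ⊆ sepSystem G k ∧ {v : V | ∀ s ∈ F, v ∈ s.right}.ncard < k}

/-- `𝓟_k`: the sets `{(A, B), (C, D), (B ∩ D, A ∪ C)} ⊆ S_k`. -/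
def profileSets (G : SimpleGraph V) (k : ℕ) : Set (Set (Separation V)) :=
  {F | F ⊆ sepSystem G k ∧ ∃ s t : Separation V, F = {s, t, s.corner t}}

end Systems

/-- A leaf: a vertex of degree 1. -/
def IsLeaf {W : Type*} (H : SimpleGraph W) (u : W) : Prop := ∃! v, H.Adj u v

/-- The graphs on which `S`-graphs are based: finite connected bipartite graphs with at least
one edge, bipartition `N ∪ M` (`N` being the complement of `M`), all leaves in `N`, and for each
`m ∈ M` a partition of the edges at `m` into two non-empty classes.  The edge `mn` belongs to the
first class iff `n ∈ first m`. -/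
structure ClassHGraph (W : Type*) where
  finite : Finite W
  graph : SimpleGraph W
  connected : graph.Connected
  exists_edge : ∃ u v, graph.Adj u v
  M : Set W
  bipartite : ∀ u v, graph.Adj u v → (u ∈ M ↔ v ∉ M)
  leaf_notMem : ∀ u, IsLeaf graph u → u ∉ M
  first : W → Set W
  first_nonempty : ∀ m ∈ M, ∃ n, graph.Adj m n ∧ n ∈ first m
  second_nonempty : ∀ m ∈ M, ∃ n, graph.Adj m n ∧ n ∉ first m

/-- An `S`-graph over `F` rooted in `Sm`. -/
structure SGraph {V : Type*} [Fintype V] [DecidableEq V]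
    (S Sm : Set (Separation V)) (F : Set (Set (Separation V))) (W : Type*)
    extends ClassHGraph W where
  α : graph.Dart → Separation V
  α_mem : ∀ d, α d ∈ S
  α_symm : ∀ d, α d.symm = (α d).inv
  rooted : ∀ d, IsLeaf graph d.fst → α d ∈ Sm
  over_sets : ∀ n, n ∉ M → ¬ IsLeaf graph n →
    {s | ∃ d : graph.Dart, d.snd = n ∧ α d = s} ∈ F
  inconsistent : ∀ m ∈ M, ∀ d e : graph.Dart, d.snd = m → e.fst = m →
    d.fst ∈ first m → e.snd ∉ first m → α e ≤ α d

/-- An `S`-tree over `F` rooted in `Sm`. -/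
structure STree {V : Type*} [Fintype V] [DecidableEq V]
    (S Sm : Set (Separation V)) (F : Set (Set (Separation V))) (W : Type*) where
  finite : Finite W
  graph : SimpleGraph W
  isTree : graph.IsTree
  exists_edge : ∃ u v, graph.Adj u v
  α : graph.Dart → Separation V
  α_mem : ∀ d, α d ∈ S
  α_symm : ∀ d, α d.symm = (α d).inv
  rooted : ∀ d, IsLeaf graph d.fst → α d ∈ Sm
  over_sets : ∀ n, ¬ IsLeaf graph n →
    {s | ∃ d : graph.Dart, d.snd = n ∧ α d = s} ∈ F

/-- There is an `S`-graph over `F` rooted in `Sm` whose underlying graph is a tree. -/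
def HasTreeSGraph {V : Type*} [Fintype V] [DecidableEq V]
    (S Sm : Set (Separation V)) (F : Set (Set (Separation V))) : Prop :=
  ∃ (W : Type) (H : SGraph S Sm F W), H.graph.IsTree

/-- There is an `S`-tree over `F` rooted in `Sm`. -/
def HasSTree {V : Type*} [Fintype V] [DecidableEq V]
    (S Sm : Set (Separation V)) (F : Set (Set (Separation V))) : Prop :=
  ∃ W : Type, Nonempty (STree S Sm F W)

/-- Four 5-sets arranged cyclically on 12 vertices, consecutive ones sharing two vertices. -/
def corners : Fin 4 → Finset (Fin 12) :=
  ![{10, 11, 0, 1, 2}, {1, 2, 3, 4, 5}, {4, 5, 6, 7, 8}, {7, 8, 9, 10, 11}]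

/-- The vertex of `corners i` that lies in no other `corners j`. -/
def cornerVertex : Fin 4 → Fin 12 := ![0, 3, 6, 9]

/-- The union of the complete graphs on the four sets `corners i`. -/
def cornerGraph : SimpleGraph (Fin 12) where
  Adj x y := x ≠ y ∧ ∃ i, x ∈ corners i ∧ y ∈ corners i
  symm := ⟨fun _ _ h => ⟨h.1.symm, h.2.imp fun _ hi => ⟨hi.2, hi.1⟩⟩⟩
  loopless := ⟨fun _ h => h.1 rfl⟩

/-- The separation `(A, B)`. -/
def sepAB : Separation (Fin 12) :=
  ⟨corners 0 ∪ corners 1, corners 2 ∪ corners 3, by decide⟩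

/-- The separation `(C, D)`. -/
def sepCD : Separation (Fin 12) :=
  ⟨corners 1 ∪ corners 2, corners 3 ∪ corners 0, by decide⟩

/-- The corner separation `(E, F)` with `E = corners i` and `F` the complement of its corner
vertex. -/
def cornerSep (i : Fin 4) : Separation (Fin 12) :=
  ⟨corners i, {cornerVertex i}ᶜ, by revert i; decide⟩

/-!
The graph is a cyclic arrangement of four `K₅`s, consecutive ones sharing a *link* of two vertices.

*Blocks.* Two non-adjacent vertices are split by one of the two crossing 4-separations, so for
`k ≥ 5` the inseparable sets are the cliques (`isInseparable_cornerGraph_iff`), and a clique, being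
split by neither of them, lies in one of the `K₅`s (`IsClique.exists_subset_corners`).

*Profiles.* A 6-profile would contain every `(E, V)` with `E` a `K₅`, hence also the corner
separation `(E, F)`; but whichever way it orients the two crossing separations, these have one of
the `(E, F)` as a corner.

*Trees.* The set `X` of the eight link vertices behaves like a block towards a tree, although it is
not one: every link vertex has at least six link vertices in its closed neighbourhood. Hence a
separation `(A, B)` with `X ⊈ A` satisfies `|X ∩ B| ≥ 6`. Call an oriented edge of the tree useful
(for its head) if its separation `(A, B)` has `X ⊈ B`. At a node whose set is in `𝓑₆` some useful
incoming edge is not useful in the other direction, or else there are two useful incoming edges,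
since the `B` of a single edge that is useful both ways contains six vertices of `X`. The same holds at leaves, and at the nodes
in `M` because of their inconsistency condition. Counting an edge with weight two if
it is useful in one direction only, and with weight one at both ends if it is useful in both, every
node receives weight at least two, which is impossible since a tree has fewer edges than nodes
(`SimpleGraph.IsTree.exists_vertex_of_dart_pred`). Since `𝓟₆ ⊆ 𝓑₆`, this covers both families.
-/

/-! ### Counting in trees -/

open scoped Classical in
/-- If some of the oriented edges of a finite tree are marked, then at some vertex every marked
incoming edge is also marked in the other direction, and there is at most one of them. Otherwise,
the weights `w` in the proof would sum to at least two at every vertex but to at most two on every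
edge. -/
theorem SimpleGraph.IsTree.exists_vertex_of_dart_pred {W : Type*} [Finite W] {T : SimpleGraph W}
    (hT : T.IsTree) (U : T.Dart → Prop) :
    ∃ v, (∀ d : T.Dart, d.snd = v → U d → U d.symm) ∧
      ∀ d e : T.Dart, d.snd = v → e.snd = v → U d → U e → d = e := by
  have := Fintype.ofFinite W
  by_contra! hcon
  let w : T.Dart → ℕ := fun d => if U d then (if U d.symm then 1 else 2) else 0
  have hpair : ∀ d, w d + w d.symm ≤ 2 := by
    intro d
    simp only [w, SimpleGraph.Dart.symm_symm]
    split_ifs <;> simp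
  have hvertex : ∀ v, 2 ≤ ∑ d : T.Dart with d.snd = v, w d := by
    intro v
    by_cases h : ∀ d : T.Dart, d.snd = v → U d → U d.symm
    · obtain ⟨d, e, hd, he, hUd, hUe, hne⟩ := hcon v h
      calc 2 = ∑ x ∈ {d, e}, w x := by
            rw [Finset.sum_pair hne]
            simp [w, hUd, hUe, h d hd hUd, h e he hUe]
        _ ≤ _ := Finset.sum_le_sum_of_subset (by
            intro x hx
            rcases Finset.mem_insert.1 hx with rfl | hx
            · simpa using hd
            · rw [Finset.mem_singleton.1 hx]; simpa using he)
    · push Not at h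
      obtain ⟨d, hd, hUd, hUd'⟩ := h
      calc 2 = w d := by simp [w, hUd, hUd']
        _ ≤ _ := Finset.single_le_sum (f := w) (fun _ _ => Nat.zero_le _) (by simpa using hd)
  have hlower : 2 * Fintype.card W ≤ ∑ d : T.Dart, w d := by
    rw [← Finset.sum_fiberwise Finset.univ (fun d : T.Dart => d.snd) w]
    calc 2 * Fintype.card W = ∑ _v : W, 2 := by simp [mul_comm]
      _ ≤ _ := Finset.sum_le_sum fun v _ => hvertex v
  have hsymm : ∑ d : T.Dart, w d.symm = ∑ d : T.Dart, w d :=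
    Equiv.sum_comp (Function.Involutive.toPerm _ SimpleGraph.Dart.symm_involutive) w
  have hupper : 2 * ∑ d : T.Dart, w d ≤ 2 * Fintype.card T.Dart := by
    calc 2 * ∑ d : T.Dart, w d = ∑ d : T.Dart, (w d + w d.symm) := by
          rw [Finset.sum_add_distrib, hsymm, two_mul]
      _ ≤ ∑ _d : T.Dart, 2 := Finset.sum_le_sum fun d _ => hpair d
      _ = _ := by simp [mul_comm]
  have hedges := hT.card_edgeFinset
  have hdarts := T.dart_card_eq_twice_card_edges
  omega

/-! ### Separations and trees of separations -/

theorem VertexSeparates.symm {V : Type*} {G : SimpleGraph V} {Z : Finset V} {x y : V}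
    (h : VertexSeparates G Z x y) : VertexSeparates G Z y x := by
  intro p
  obtain ⟨z, hz, hzp⟩ := h p.reverse
  exact ⟨z, hz, by simpa using hzp⟩

theorem SimpleGraph.IsClique.isInseparable {V : Type*} {G : SimpleGraph V} {X : Finset V}
    (hX : G.IsClique X) (k : ℕ) : IsInseparable G k X := by
  intro x hx y hy hne Z _ hxZ hyZ h
  obtain ⟨z, hz, hzp⟩ := h (hX hx hy hne).toWalk
  simp only [SimpleGraph.Adj.toWalk, SimpleGraph.Walk.support_cons,
    SimpleGraph.Walk.support_nil, List.mem_cons, List.not_mem_nil, or_false] at hzp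
  rcases hzp with rfl | rfl <;> contradiction

section

variable {V : Type*} [Fintype V] [DecidableEq V]

namespace Separation

theorem mem_left_or_mem_right (s : Separation V) (v : V) : v ∈ s.left ∨ v ∈ s.right := by
  rw [← Finset.mem_union, s.cover]
  exact Finset.mem_univ v

theorem order_inv (s : Separation V) : s.inv.order = s.order := by
  simp [order, inv, Finset.inter_comm]

theorem IsSeparationOf.inv {s : Separation V} {G : SimpleGraph V} (h : s.IsSeparationOf G) :
    s.inv.IsSeparationOf G :=
  fun a ha b hb hab => h b hb a ha hab.symm

theorem eq_of_subset_of_order_le {s t : Separation V} (hl : t.left ⊆ s.left)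
    (hr : t.right ⊆ s.right) (ho : s.order ≤ t.order) : s = t := by
  have h : t.left ∩ t.right = s.left ∩ s.right :=
    Finset.eq_of_subset_of_card_le (Finset.inter_subset_inter hl hr) ho
  have key : ∀ x, x ∈ s.left → x ∈ s.right → x ∈ t.left ∧ x ∈ t.right := fun x h1 h2 =>
    Finset.mem_inter.1 (h ▸ Finset.mem_inter.2 ⟨h1, h2⟩)
  ext x
  · refine ⟨fun hx => ?_, fun hx => hl hx⟩
    rcases t.mem_left_or_mem_right x with h' | h'
    · exact h'
    · exact (key x hx (hr h')).1
  · refine ⟨fun hx => ?_, fun hx => hr hx⟩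
    rcases t.mem_left_or_mem_right x with h' | h'
    · exact (key x (hl h') hx).2
    · exact h'

/-- A clique lies on one side of every separation. -/
theorem IsSeparationOf.subset_or_subset {s : Separation V} {G : SimpleGraph V}
    (hs : s.IsSeparationOf G) {K : Finset V} (hK : G.IsClique K) : K ⊆ s.left ∨ K ⊆ s.right := by
  by_contra! h
  obtain ⟨⟨x, hxK, hx⟩, y, hyK, hy⟩ :=
    And.imp Finset.not_subset.1 Finset.not_subset.1 h
  have hx' := (s.mem_left_or_mem_right x).resolve_left hx
  have hy' := (s.mem_left_or_mem_right y).resolve_right hy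
  refine hs y (Finset.mem_sdiff.2 ⟨hy', hy⟩) x (Finset.mem_sdiff.2 ⟨hx', hx⟩) (hK hyK hxK ?_)
  rintro rfl
  exact hx hy'

theorem IsSeparationOf.vertexSeparates {s : Separation V} {G : SimpleGraph V}
    (hs : s.IsSeparationOf G) {x y : V} (hx : x ∈ s.left \ s.right) (hy : y ∈ s.right \ s.left) :
    VertexSeparates G (s.left ∩ s.right) x y := by
  intro p
  induction p with
  | nil =>
    simp only [Finset.mem_sdiff] at hx hy
    exact absurd hx.1 hy.2
  | @cons u v w huv p ih =>
    by_cases hv : v ∈ s.left \ s.right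
    · obtain ⟨z, hz, hzp⟩ := ih hv hy
      exact ⟨z, hz, by simp [hzp]⟩
    · refine ⟨v, ?_, by simp⟩
      have h := fun h' => hs u hx v h' huv
      have := s.mem_left_or_mem_right v
      simp only [Finset.mem_sdiff, Finset.mem_inter] at h hv ⊢
      tauto

end Separation

/-- Inside the last of the three sets `B`, `D`, `A ∪ C`, the intersection of the first two is the
separator of the corner separation. -/
theorem profileSets_subset_blockSets (G : SimpleGraph V) (k : ℕ) :
    profileSets G k ⊆ blockSets G k := by
  rintro F ⟨hF, s, t, rfl⟩
  refine ⟨hF, ?_⟩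
  have hcorner : (s.corner t).order < k := (hF (by simp)).2
  have hset : {v : V | ∀ r ∈ ({s, t, s.corner t} : Set (Separation V)), v ∈ r.right} =
      ((s.corner t).left ∩ (s.corner t).right : Finset V) := by
    ext v
    simp [Separation.corner]
  rw [hset, Set.ncard_coe_finset]
  exact hcorner

/-- If every vertex of `X` has at least `k` vertices of `X` in its closed neighbourhood, then no
finite tree carries separations of order less than `k` such that every node is of one of three
kinds: one from which an edge with a separation in `S_k⁻` leaves, one whose incoming separations
form a set in `𝓑_k`, or one with two edges on which the separations point away from each other. -/
theorem SimpleGraph.IsTree.false_of_separations {G : SimpleGraph V} [DecidableRel G.Adj] {k : ℕ}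
    {X : Finset V} (hXk : k ≤ X.card)
    (hX : ∀ x ∈ X, k ≤ (X.filter fun y => y = x ∨ G.Adj x y).card)
    {W : Type*} [Finite W] {T : SimpleGraph W} (hT : T.IsTree) (α : T.Dart → Separation V)
    (hα : ∀ d, α d ∈ sepSystem G k) (hsymm : ∀ d, α d.symm = (α d).inv)
    (hnode : ∀ v, (∃ d, d.fst = v ∧ α d ∈ smallSeps V k) ∨
      {s | ∃ d : T.Dart, d.snd = v ∧ α d = s} ∈ blockSets G k ∨
      ∃ d e : T.Dart, d.snd = v ∧ e.fst = v ∧ d ≠ e.symm ∧ α e ≤ α d) : False := by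
  have hleft : ∀ d, (α d.symm).right = (α d).left := fun d => by rw [hsymm]; rfl
  have hright : ∀ d, (α d.symm).left = (α d).right := fun d => by rw [hsymm]; rfl
  have hlarge : ∀ d, ¬ X ⊆ (α d).left → k ≤ (X ∩ (α d).right).card := by
    intro d h
    obtain ⟨x, hx, hxl⟩ := Finset.not_subset.1 h
    have hxr := ((α d).mem_left_or_mem_right x).resolve_left hxl
    refine (hX x hx).trans (Finset.card_le_card fun y hy => ?_)
    obtain ⟨hyX, hyx⟩ := Finset.mem_filter.1 hy
    refine Finset.mem_inter.2 ⟨hyX, ?_⟩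
    rcases hyx with rfl | hadj
    · exact hxr
    · by_contra hyr
      have hyl := ((α d).mem_left_or_mem_right y).resolve_right hyr
      exact (hα d).1 y (Finset.mem_sdiff.2 ⟨hyl, hyr⟩) x (Finset.mem_sdiff.2 ⟨hxr, hxl⟩) hadj.symm
  obtain ⟨v, hv, hv'⟩ := hT.exists_vertex_of_dart_pred fun d => ¬ X ⊆ (α d).right
  have hv_left : ∀ d : T.Dart, d.snd = v → ¬ X ⊆ (α d).right → ¬ X ⊆ (α d).left :=
    fun d hd h => hleft d ▸ hv d hd h
  rcases hnode v with ⟨d, hd, hright_univ, hcard⟩ | ⟨-, hcard⟩ | ⟨d, e, hd, he, hne, hle⟩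
  · refine hv_left d.symm hd (fun h => ?_) ?_
    · rw [hleft] at h
      exact absurd (Finset.card_le_card h) (by omega)
    · rw [hright, hright_univ]
      exact Finset.subset_univ _
  · -- All right sides contain `X ∩ Y` for some `Y` with `k ≤ |X ∩ Y|`.
    obtain ⟨Y, hY, hsub⟩ : ∃ Y : Finset V, k ≤ (X ∩ Y).card ∧
        ∀ d : T.Dart, d.snd = v → X ∩ Y ⊆ (α d).right := by
      by_cases h : ∃ d : T.Dart, d.snd = v ∧ ¬ X ⊆ (α d).right
      · obtain ⟨d, hd, hdX⟩ := h
        refine ⟨(α d).right, hlarge d (hv_left d hd hdX), fun e he => ?_⟩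
        by_cases heX : X ⊆ (α e).right
        · exact Finset.inter_subset_left.trans heX
        · rw [hv' d e hd he hdX heX]
          exact Finset.inter_subset_right
      · push Not at h
        exact ⟨Finset.univ, by simpa using hXk, fun d hd => by simpa using h d hd⟩
    have hle : ((X ∩ Y : Finset V) : Set V) ⊆
        {x : V | ∀ s ∈ {s | ∃ d : T.Dart, d.snd = v ∧ α d = s}, x ∈ s.right} := by
      rintro x hx _ ⟨d, hd, rfl⟩
      exact hsub d hd hx
    have := Set.ncard_le_ncard hle (Set.toFinite _)
    rw [Set.ncard_coe_finset] at this
    omega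
  · -- As `X` is larger than every separator, it cannot lie on both sides of a separation.
    have hboth : ∀ d, X ⊆ (α d).left → ¬ X ⊆ (α d).right := fun d hl hr =>
      absurd (Finset.card_le_card (Finset.subset_inter hl hr)) (by
        have : ((α d).left ∩ (α d).right).card < k := (hα d).2
        omega)
    by_cases hdX : X ⊆ (α d).right
    · have heX := hdX.trans hle.2
      exact hv_left e.symm he (fun h => hboth e (hleft e ▸ h) heX) (hright e ▸ heX)
    · by_cases heX : X ⊆ (α e).left
      · exact hv_left d hd hdX (heX.trans hle.1)
      · exact hne (hv' d e.symm hd he hdX (hleft e ▸ heX))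

theorem SGraph.not_isTree {G : SimpleGraph V} [DecidableRel G.Adj] {k : ℕ}
    {X : Finset V} (hXk : k ≤ X.card)
    (hX : ∀ x ∈ X, k ≤ (X.filter fun y => y = x ∨ G.Adj x y).card)
    {F : Set (Set (Separation V))} (hF : F ⊆ blockSets G k) {W : Type*}
    (H : SGraph (sepSystem G k) (smallSeps V k) F W) : ¬ H.graph.IsTree := by
  intro hT
  have := H.finite
  refine hT.false_of_separations hXk hX H.α H.α_mem H.α_symm fun v => ?_
  by_cases hleaf : IsLeaf H.graph v
  · obtain ⟨u, hu, -⟩ := id hleaf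
    exact Or.inl ⟨⟨(v, u), hu⟩, rfl, H.rooted _ hleaf⟩
  by_cases hM : v ∈ H.M
  · obtain ⟨n, hn, hn1⟩ := H.first_nonempty v hM
    obtain ⟨n', hn', hn2⟩ := H.second_nonempty v hM
    refine Or.inr (Or.inr ⟨⟨(n, v), hn.symm⟩, ⟨(v, n'), hn'⟩, rfl, rfl, fun h => ?_,
      H.inconsistent v hM _ _ rfl rfl hn1 hn2⟩)
    have : n = n' := congrArg (fun d => d.fst) h
    exact hn2 (this ▸ hn1)
  · exact Or.inr (Or.inl (hF (H.over_sets v hM hleaf)))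

theorem STree.isEmpty {G : SimpleGraph V} [DecidableRel G.Adj] {k : ℕ}
    {X : Finset V} (hXk : k ≤ X.card)
    (hX : ∀ x ∈ X, k ≤ (X.filter fun y => y = x ∨ G.Adj x y).card)
    {F : Set (Set (Separation V))} (hF : F ⊆ blockSets G k) (W : Type*) :
    IsEmpty (STree (sepSystem G k) (smallSeps V k) F W) := by
  refine ⟨fun T => ?_⟩
  have := T.finite
  refine T.isTree.false_of_separations hXk hX T.α T.α_mem T.α_symm fun v => ?_
  by_cases hleaf : IsLeaf T.graph v
  · obtain ⟨u, hu, -⟩ := id hleaf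
    exact Or.inl ⟨⟨(v, u), hu⟩, rfl, T.rooted _ hleaf⟩
  · exact Or.inr (Or.inl (hF (T.over_sets v hleaf)))

/-- A profile contains `(E, F)` if `|E| < k`: it contains `(E, V)`, which is a corner of `(F, E)`
and `(E, V)`. -/
theorem IsProfile.mem_of_card_left_lt {G : SimpleGraph V} {k : ℕ} {P : Set (Separation V)}
    (hP : IsProfile G k P) {s : Separation V} (hs : s ∈ sepSystem G k) (hcard : s.left.card < k) :
    s ∈ P := by
  obtain ⟨⟨-, hor, -⟩, hcons, hprof⟩ := hP
  let t : Separation V := ⟨s.left, Finset.univ, by simp⟩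
  have htS : t ∈ sepSystem G k := by
    refine ⟨fun a ha => by simp [t] at ha, ?_⟩
    simpa [t, Separation.order] using hcard
  have ht : t ∈ P := by
    refine (hor t htS).resolve_right fun h => hcons _ h _ h ?_
    exact ⟨Finset.subset_univ _, Finset.subset_univ _⟩
  refine (hor s hs).resolve_right fun h => hprof _ h _ ht ?_
  have : s.inv.corner t = t := by
    ext x
    · simp [Separation.corner, Separation.inv, t]
    · simpa [Separation.corner, Separation.inv, t] using (s.mem_left_or_mem_right x).symm
  rwa [this]

end

/-! ### The cyclic arrangement of four complete graphs -/

instance : DecidableRel cornerGraph.Adj := fun x y =>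
  inferInstanceAs (Decidable (x ≠ y ∧ ∃ i, x ∈ corners i ∧ y ∈ corners i))

instance {V : Type*} [Fintype V] [DecidableEq V] (G : SimpleGraph V) [DecidableRel G.Adj]
    (s : Separation V) : Decidable (s.IsSeparationOf G) :=
  inferInstanceAs (Decidable (∀ a ∈ s.left \ s.right, ∀ b ∈ s.right \ s.left, ¬ G.Adj a b))

theorem sepAB_isSeparationOf : sepAB.IsSeparationOf cornerGraph := by decide

theorem sepCD_isSeparationOf : sepCD.IsSeparationOf cornerGraph := by decide

theorem cornerSep_isSeparationOf (i : Fin 4) : (cornerSep i).IsSeparationOf cornerGraph := by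
  revert i; decide

theorem sepAB_order : sepAB.order = 4 := by decide

theorem sepCD_order : sepCD.order = 4 := by decide

theorem cornerSep_order (i : Fin 4) : (cornerSep i).order = 4 := by revert i; decide

theorem card_corners (i : Fin 4) : (corners i).card = 5 := by revert i; decide

theorem isClique_corners (i : Fin 4) : cornerGraph.IsClique (corners i) :=
  fun _ hx _ hy hne => ⟨hne, i, hx, hy⟩

theorem corners_injective : Function.Injective corners := by
  intro i j; revert i j; decide

/-- The union of the four links, that is, of the intersections of consecutive `corners`. -/
def links : Finset (Fin 12) := {1, 2, 4, 5, 7, 8, 10, 11}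

theorem six_le_card_links : 6 ≤ links.card := by decide

theorem six_le_card_links_filter :
    ∀ x ∈ links, 6 ≤ (links.filter fun y => y = x ∨ cornerGraph.Adj x y).card := by decide

theorem splits_of_not_adj :
    ∀ x y : Fin 12, x ≠ y → ¬ cornerGraph.Adj x y → sepAB.Splits x y ∨ sepCD.Splits x y := by
  unfold Separation.Splits
  decide

theorem SimpleGraph.IsClique.exists_subset_corners {X : Finset (Fin 12)}
    (hX : cornerGraph.IsClique X) : ∃ i, X ⊆ corners i := by
  rcases sepAB_isSeparationOf.subset_or_subset hX with h | h <;>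
    rcases sepCD_isSeparationOf.subset_or_subset hX with h' | h'
  · exact ⟨1, (Finset.subset_inter h h').trans (by decide)⟩
  · exact ⟨0, (Finset.subset_inter h h').trans (by decide)⟩
  · exact ⟨2, (Finset.subset_inter h h').trans (by decide)⟩
  · exact ⟨3, (Finset.subset_inter h h').trans (by decide)⟩

theorem SimpleGraph.IsClique.exists_eq_corners {X : Finset (Fin 12)}
    (hX : cornerGraph.IsClique X) (hcard : 5 ≤ X.card) : ∃ i, X = corners i := by
  obtain ⟨i, hi⟩ := hX.exists_subset_corners
  exact ⟨i, Finset.eq_of_subset_of_card_le hi (by rwa [card_corners])⟩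

theorem isInseparable_cornerGraph_iff {k : ℕ} (hk : 5 ≤ k) {X : Finset (Fin 12)} :
    IsInseparable cornerGraph k X ↔ cornerGraph.IsClique X := by
  refine ⟨fun h x hx y hy hne => ?_, fun h => h.isInseparable k⟩
  by_contra hadj
  have key : ∀ s : Separation (Fin 12), s.IsSeparationOf cornerGraph → s.order = 4 →
      ¬ s.Splits x y := by
    rintro s hs ho (⟨hx', hy'⟩ | ⟨hy', hx'⟩)
    · refine h x hx y hy hne (s.left ∩ s.right) (ho.trans_lt (by omega)) ?_ ?_
        (hs.vertexSeparates hx' hy') <;> simp_all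
    · refine h x hx y hy hne (s.left ∩ s.right) (ho.trans_lt (by omega)) ?_ ?_
        (hs.vertexSeparates hy' hx').symm <;> simp_all
  rcases splits_of_not_adj x y hne hadj with h' | h'
  · exact key _ sepAB_isSeparationOf sepAB_order h'
  · exact key _ sepCD_isSeparationOf sepCD_order h'

theorem isBlock_five_cornerGraph_iff {X : Finset (Fin 12)} :
    IsBlock cornerGraph 5 X ↔ ∃ i, X = corners i := by
  simp only [IsBlock, isInseparable_cornerGraph_iff le_rfl]
  refine ⟨fun h => h.prop.2.exists_eq_corners h.prop.1, ?_⟩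
  rintro ⟨i, rfl⟩
  refine ⟨⟨(card_corners i).ge, isClique_corners i⟩, fun Y hY hle => ?_⟩
  obtain ⟨j, rfl⟩ := hY.2.exists_eq_corners hY.1
  exact (Finset.eq_of_subset_of_card_le hle (by simp only [card_corners, le_refl])).ge

theorem not_isBlock_six_cornerGraph (X : Finset (Fin 12)) : ¬ IsBlock cornerGraph 6 X := by
  intro h
  have hcard := h.prop.1
  obtain ⟨i, rfl⟩ := ((isInseparable_cornerGraph_iff (by norm_num)).1 h.prop.2).exists_eq_corners
    (by omega)
  rw [card_corners] at hcard
  omega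

theorem not_isProfile_six_cornerGraph (P : Set (Separation (Fin 12))) :
    ¬ IsProfile cornerGraph 6 P := by
  intro hP
  have hcorner : ∀ i, cornerSep i ∈ P := fun i =>
    hP.mem_of_card_left_lt ⟨cornerSep_isSeparationOf i, by rw [cornerSep_order]; norm_num⟩
      (by change (corners i).card < 6; rw [card_corners]; norm_num)
  have key : ∀ s ∈ P, ∀ t ∈ P, ∀ i, s.corner t ≠ cornerSep i := fun s hs t ht i h =>
    hP.2.2 s hs t ht (h ▸ hcorner i)
  rcases hP.1.2.1 sepAB ⟨sepAB_isSeparationOf, by rw [sepAB_order]; norm_num⟩ with h | h <;>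
    rcases hP.1.2.1 sepCD ⟨sepCD_isSeparationOf, by rw [sepCD_order]; norm_num⟩ with h' | h'
  · exact key _ h _ h' 3 (Separation.ext (by decide) (by decide))
  · exact key _ h _ h' 2 (Separation.ext (by decide) (by decide))
  · exact key _ h _ h' 0 (Separation.ext (by decide) (by decide))
  · exact key _ h _ h' 1 (Separation.ext (by decide) (by decide))

/-- Each of the four `K₅`s lies on exactly one side, and which ones lie on the left determines the
separation. -/
theorem eq_of_mem_sepSystem_five {s : Separation (Fin 12)} (hs : s ∈ sepSystem cornerGraph 5)
    (hp : s.IsProper) :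
    s = sepAB ∨ s = sepAB.inv ∨ s = sepCD ∨ s = sepCD.inv ∨
      ∃ i, s = cornerSep i ∨ s = (cornerSep i).inv := by
  obtain ⟨hsep, hord⟩ := hs
  have heq : ∀ t : Separation (Fin 12), t.order = 4 → t.left ⊆ s.left → t.right ⊆ s.right →
      s = t := fun t ht hl hr => Separation.eq_of_subset_of_order_le hl hr (by omega)
  have hAB (h0 : corners 0 ⊆ s.left) (h1 : corners 1 ⊆ s.left) (h2 : corners 2 ⊆ s.right)
      (h3 : corners 3 ⊆ s.right) : s = sepAB :=
    heq sepAB sepAB_order (Finset.union_subset h0 h1) (Finset.union_subset h2 h3)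
  have hBA (h0 : corners 0 ⊆ s.right) (h1 : corners 1 ⊆ s.right) (h2 : corners 2 ⊆ s.left)
      (h3 : corners 3 ⊆ s.left) : s = sepAB.inv :=
    heq sepAB.inv (by rw [Separation.order_inv, sepAB_order])
      (Finset.union_subset h2 h3) (Finset.union_subset h0 h1)
  have hCD (h0 : corners 0 ⊆ s.right) (h1 : corners 1 ⊆ s.left) (h2 : corners 2 ⊆ s.left)
      (h3 : corners 3 ⊆ s.right) : s = sepCD :=
    heq sepCD sepCD_order (Finset.union_subset h1 h2) (Finset.union_subset h3 h0)
  have hDC (h0 : corners 0 ⊆ s.left) (h1 : corners 1 ⊆ s.right) (h2 : corners 2 ⊆ s.right)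
      (h3 : corners 3 ⊆ s.left) : s = sepCD.inv :=
    heq sepCD.inv (by rw [Separation.order_inv, sepCD_order])
      (Finset.union_subset h3 h0) (Finset.union_subset h1 h2)
  have hcompl : ∀ i : Fin 4, (cornerSep i).right =
      corners (i + 1) ∪ corners (i + 2) ∪ corners (i + 3) := by decide
  have hE (i : Fin 4) (h : corners i ⊆ s.left) (h1 : corners (i + 1) ⊆ s.right)
      (h2 : corners (i + 2) ⊆ s.right) (h3 : corners (i + 3) ⊆ s.right) : s = cornerSep i :=
    heq _ (cornerSep_order i) h
      (hcompl i ▸ Finset.union_subset (Finset.union_subset h1 h2) h3)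
  have hF (i : Fin 4) (h : corners i ⊆ s.right) (h1 : corners (i + 1) ⊆ s.left)
      (h2 : corners (i + 2) ⊆ s.left) (h3 : corners (i + 3) ⊆ s.left) : s = (cornerSep i).inv :=
    heq _ (by rw [Separation.order_inv, cornerSep_order])
      (show (cornerSep i).right ⊆ _ from
        hcompl i ▸ Finset.union_subset (Finset.union_subset h1 h2) h3) h
  -- If opposite `K₅`s lie on the left and the other two on the right, the separator contains all
  -- eight link vertices.
  have hlinks : ¬ links ⊆ s.left ∩ s.right := fun h =>
    absurd (Finset.card_le_card h) (by
      have : (s.left ∩ s.right).card < 5 := hord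
      have := six_le_card_links
      omega)
  have h02 : links ⊆ corners 0 ∪ corners 2 := by decide
  have h13 : links ⊆ corners 1 ∪ corners 3 := by decide
  have huniv : corners 0 ∪ corners 1 ∪ (corners 2 ∪ corners 3) = Finset.univ := by decide
  have hside := fun i => hsep.subset_or_subset (isClique_corners i)
  rcases hside 0 with h0 | h0 <;> rcases hside 1 with h1 | h1 <;>
    rcases hside 2 with h2 | h2 <;> rcases hside 3 with h3 | h3
  · exact absurd (Finset.univ_subset_iff.1 (huniv ▸ Finset.union_subset
      (Finset.union_subset h0 h1) (Finset.union_subset h2 h3))) hp.1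
  · exact .inr (.inr (.inr (.inr ⟨3, .inr (hF 3 h3 h0 h1 h2)⟩)))
  · exact .inr (.inr (.inr (.inr ⟨2, .inr (hF 2 h2 h3 h0 h1)⟩)))
  · exact .inl (hAB h0 h1 h2 h3)
  · exact .inr (.inr (.inr (.inr ⟨1, .inr (hF 1 h1 h2 h3 h0)⟩)))
  · exact absurd (Finset.subset_inter (h02.trans (Finset.union_subset h0 h2))
      (h13.trans (Finset.union_subset h1 h3))) hlinks
  · exact .inr (.inr (.inr (.inl (hDC h0 h1 h2 h3))))
  · exact .inr (.inr (.inr (.inr ⟨0, .inl (hE 0 h0 h1 h2 h3)⟩)))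
  · exact .inr (.inr (.inr (.inr ⟨0, .inr (hF 0 h0 h1 h2 h3)⟩)))
  · exact .inr (.inr (.inl (hCD h0 h1 h2 h3)))
  · exact absurd (Finset.subset_inter (h13.trans (Finset.union_subset h1 h3))
      (h02.trans (Finset.union_subset h0 h2))) hlinks
  · exact .inr (.inr (.inr (.inr ⟨1, .inl (hE 1 h1 h2 h3 h0)⟩)))
  · exact .inr (.inl (hBA h0 h1 h2 h3))
  · exact .inr (.inr (.inr (.inr ⟨2, .inl (hE 2 h2 h3 h0 h1)⟩)))
  · exact .inr (.inr (.inr (.inr ⟨3, .inl (hE 3 h3 h0 h1 h2)⟩)))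
  · exact absurd (Finset.univ_subset_iff.1 (huniv ▸ Finset.union_subset
      (Finset.union_subset h0 h1) (Finset.union_subset h2 h3))) hp.2

theorem mem_sepSystem_five_and_isProper_iff (s : Separation (Fin 12)) :
    (s ∈ sepSystem cornerGraph 5 ∧ s.IsProper) ↔
      (s = sepAB ∨ s = sepAB.inv ∨ s = sepCD ∨ s = sepCD.inv ∨
        ∃ i, s = cornerSep i ∨ s = (cornerSep i).inv) := by
  refine ⟨fun h => eq_of_mem_sepSystem_five h.1 h.2, fun h => ?_⟩
  have mem : ∀ t : Separation (Fin 12), t.IsSeparationOf cornerGraph → t.order = 4 →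
      t ∈ sepSystem cornerGraph 5 ∧ t.inv ∈ sepSystem cornerGraph 5 := fun t ht ho =>
    ⟨⟨ht, by omega⟩, ht.inv, by rw [Separation.order_inv]; omega⟩
  have hAB := mem _ sepAB_isSeparationOf sepAB_order
  have hCD := mem _ sepCD_isSeparationOf sepCD_order
  have hE := fun i => mem _ (cornerSep_isSeparationOf i) (cornerSep_order i)
  have pAB : sepAB.IsProper := ⟨by decide, by decide⟩
  have pCD : sepCD.IsProper := ⟨by decide, by decide⟩
  have pE : ∀ i, (cornerSep i).IsProper := fun i => ⟨by revert i; decide, by revert i; decide⟩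
  rcases h with rfl | rfl | rfl | rfl | ⟨i, rfl | rfl⟩
  · exact ⟨hAB.1, pAB⟩
  · exact ⟨hAB.2, pAB.symm⟩
  · exact ⟨hCD.1, pCD⟩
  · exact ⟨hCD.2, pCD.symm⟩
  · exact ⟨(hE i).1, pE i⟩
  · exact ⟨(hE i).2, (pE i).symm⟩

theorem mainTheorem5 :
    -- the `K₅`s of the graph
    (∀ X : Finset (Fin 12), cornerGraph.IsNClique 5 X ↔ ∃ i, X = corners i) ∧
    -- the two crossing 4-separations, and the four corners they define
    sepAB.IsSeparationOf cornerGraph ∧ sepAB.order = 4 ∧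
    sepCD.IsSeparationOf cornerGraph ∧ sepCD.order = 4 ∧
    ¬ sepAB.IsNested sepCD ∧
    sepAB.right ∩ sepCD.left = corners 2 ∧ sepAB.right ∩ sepCD.right = corners 3 ∧
    sepAB.left ∩ sepCD.left = corners 1 ∧ sepAB.left ∩ sepCD.right = corners 0 ∧
    -- the proper separations of order less than 5
    (∀ s : Separation (Fin 12), (s ∈ sepSystem cornerGraph 5 ∧ s.IsProper) ↔
      (s = sepAB ∨ s = sepAB.inv ∨ s = sepCD ∨ s = sepCD.inv ∨
        ∃ i, s = cornerSep i ∨ s = (cornerSep i).inv)) ∧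
    -- non-adjacent vertices are separated by one of the two 4-separations
    (∀ x y : Fin 12, x ≠ y → ¬ cornerGraph.Adj x y → sepAB.Splits x y ∨ sepCD.Splits x y) ∧
    -- four 5-blocks, the `K₅`s, but no 6-block and no 6-profile
    {X | IsBlock cornerGraph 5 X} = Set.range corners ∧
    {X | IsBlock cornerGraph 5 X}.ncard = 4 ∧
    (¬ ∃ X, IsBlock cornerGraph 6 X) ∧
    (¬ ∃ P, IsProfile cornerGraph 6 P) ∧
    -- no `S₆`-graph over `𝓑₆` or `𝓟₆` rooted in `S₆⁻` is a tree
    (∀ (W : Type*) (H : SGraph (sepSystem cornerGraph 6) (smallSeps (Fin 12) 6)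
      (blockSets cornerGraph 6) W), ¬ H.graph.IsTree) ∧
    (∀ (W : Type*) (H : SGraph (sepSystem cornerGraph 6) (smallSeps (Fin 12) 6)
      (profileSets cornerGraph 6) W), ¬ H.graph.IsTree) ∧
    -- nor is there an `S₆`-tree over `𝓑₆` or `𝓟₆` rooted in `S₆⁻`
    (∀ W : Type*, IsEmpty (STree (sepSystem cornerGraph 6) (smallSeps (Fin 12) 6)
      (blockSets cornerGraph 6) W)) ∧
    (∀ W : Type*, IsEmpty (STree (sepSystem cornerGraph 6) (smallSeps (Fin 12) 6)
      (profileSets cornerGraph 6) W)) ∧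
    -- hence blocks and profiles are not dual to `S_k`-graphs on trees, nor to `S_k`-trees
    (¬ ∀ (n : ℕ) (G : SimpleGraph (Fin n)) (k : ℕ), 0 < k →
      ((∃ X, IsBlock G k X) ↔
        ¬ HasTreeSGraph (sepSystem G k) (smallSeps (Fin n) k) (blockSets G k))) ∧
    (¬ ∀ (n : ℕ) (G : SimpleGraph (Fin n)) (k : ℕ), 0 < k →
      ((∃ P, IsProfile G k P) ↔
        ¬ HasTreeSGraph (sepSystem G k) (smallSeps (Fin n) k) (profileSets G k))) ∧
    (¬ ∀ (n : ℕ) (G : SimpleGraph (Fin n)) (k : ℕ), 0 < k →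
      ((∃ X, IsBlock G k X) ↔
        ¬ HasSTree (sepSystem G k) (smallSeps (Fin n) k) (blockSets G k))) ∧
    (¬ ∀ (n : ℕ) (G : SimpleGraph (Fin n)) (k : ℕ), 0 < k →
      ((∃ P, IsProfile G k P) ↔
        ¬ HasSTree (sepSystem G k) (smallSeps (Fin n) k) (profileSets G k))) := by
  have hSGraph {F : Set (Set (Separation (Fin 12)))} (hF : F ⊆ blockSets cornerGraph 6) :
      ¬ HasTreeSGraph (sepSystem cornerGraph 6) (smallSeps (Fin 12) 6) F := fun ⟨_, H, hT⟩ =>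
    H.not_isTree six_le_card_links six_le_card_links_filter hF hT
  have hSTree {F : Set (Set (Separation (Fin 12)))} (hF : F ⊆ blockSets cornerGraph 6) :
      ¬ HasSTree (sepSystem cornerGraph 6) (smallSeps (Fin 12) 6) F := fun ⟨W, ⟨T⟩⟩ =>
    (STree.isEmpty six_le_card_links six_le_card_links_filter hF W).false T
  have hP := profileSets_subset_blockSets cornerGraph 6
  have hblock : ¬ ∃ X, IsBlock cornerGraph 6 X := fun ⟨X, hX⟩ => not_isBlock_six_cornerGraph X hX
  have hprofile : ¬ ∃ P, IsProfile cornerGraph 6 P := fun ⟨P, hP⟩ =>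
    not_isProfile_six_cornerGraph P hP
  have hrange : {X | IsBlock cornerGraph 5 X} = Set.range corners := by
    ext X
    simp only [Set.mem_ofPred_eq, isBlock_five_cornerGraph_iff, Set.mem_range, eq_comm]
  refine ⟨fun X => ⟨fun h => h.isClique.exists_eq_corners h.card_eq.ge, ?_⟩,
    sepAB_isSeparationOf, sepAB_order, sepCD_isSeparationOf, sepCD_order, ?_,
    by decide, by decide, by decide, by decide, mem_sepSystem_five_and_isProper_iff,
    splits_of_not_adj, hrange, ?_, hblock, hprofile,
    fun W H => H.not_isTree six_le_card_links six_le_card_links_filter subset_rfl,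
    fun W H => H.not_isTree six_le_card_links six_le_card_links_filter hP,
    fun W => STree.isEmpty six_le_card_links six_le_card_links_filter subset_rfl W,
    fun W => STree.isEmpty six_le_card_links six_le_card_links_filter hP W,
    fun h => hblock ((h 12 cornerGraph 6 (by norm_num)).2 (hSGraph subset_rfl)),
    fun h => hprofile ((h 12 cornerGraph 6 (by norm_num)).2 (hSGraph hP)),
    fun h => hblock ((h 12 cornerGraph 6 (by norm_num)).2 (hSTree subset_rfl)),
    fun h => hprofile ((h 12 cornerGraph 6 (by norm_num)).2 (hSTree hP))⟩
  · rintro ⟨i, rfl⟩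
    exact ⟨isClique_corners i, card_corners i⟩
  · rintro (h | h | h | h)
    · exact absurd h.1 (by decide)
    · exact absurd h.1 (by decide)
    · exact absurd h.1 (by decide)
    · exact absurd h.1 (by decide)
  · rw [hrange, Set.ncard_range_of_injective corners_injective, Nat.card_eq_fintype_card,
      Fintype.card_fin]
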